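/- Let $\alpha>1$ be real and let $p\ge 1$ be an integer. Let $\mu_1,\dots,\mu_p$ be probability measures on $\mathbb R$ (not depending on the dimensions below), each with mean $0$, variance $1$ and finite moment of order $2\alpha$. For all positive integers $n_0,\dots,n_p$, let $A^{(q)}=(A^{(q)}_{ij})_{1\le i\le n_{q-1},\,1\le j\le n_q}$, $q=1,\dots,p$, be random matrices such that all the entries of all $p$ matrices are independent and every entry of $A^{(q)}$ has law $\mu_q$, and let $$P:=A^{(1)}\cdots A^{(p)}\in\mathbb R^{n_0\times n_p}.$$ Then, as $n_0,\dots,n_p$ all tend to infinity (jointly, in an arbitrary way; in particular when moreover $n_q\le C\,n_{q'}$ for all $q,q'$ and some fixed constant $C$), the random variable $$(n_0\cdots n_p)^{-\frac12}\sum_{i=1}^{n_0}\sum_{j=1}^{n_p}P_{ij}$$ converges in law to a centered Gaussian random variable of unit variance. -/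

import Mathlib

/-- The product `A₀ * A₁ * ⋯ * A_{p-1}` of a chain of `p` rectangular real matrices, the `q`-th of
size `n q × n (q + 1)`; the result has size `n 0 × n p`. The empty product (`p = 0`) is the
identity. -/
def chainProd : (p : ℕ) → (n : Fin (p + 1) → ℕ) →
    ((q : Fin p) → Matrix (Fin (n q.castSucc)) (Fin (n q.succ)) ℝ) →
    Matrix (Fin (n 0)) (Fin (n (Fin.last p))) ℝ
  | 0, n, _ => (1 : Matrix (Fin (n 0)) (Fin (n 0)) ℝ)
  | p + 1, n, A =>
      chainProd p (fun k => n k.castSucc) (fun q => A q.castSucc) * A (Fin.last p)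

/-- The sum of all the entries of the product of the chain, divided by the square root of
`n 0 * n 1 * ⋯ * n p`. -/
noncomputable def normalizedSum (p : ℕ) (n : Fin (p + 1) → ℕ)
    (A : (q : Fin p) → Matrix (Fin (n q.castSucc)) (Fin (n q.succ)) ℝ) : ℝ :=
  (∏ k, (n k : ℝ)) ^ (-(1 / 2) : ℝ) * ∑ i, ∑ j, chainProd p n A i j

/-! Condition on all matrices but the last one, `X`, which has `l` columns. With `c` the vector of
column sums of the product of the others, the total sum is `∑ c k * X (k, j)`: a sum of independent
variables in which each weight `c k` is used `l` times. After normalization its conditional variance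
is `T = |c|² / N`, where `N` is the product of all sizes but the last (`chainSqNorm`). Repetition of
the weights makes each of them negligible as `l → ∞`, so the conditional characteristic function at
`t` is uniformly close to `exp (-t² T / 2)` while `T` is bounded
(`exists_norm_prod_charFun_sub_exp_le`).

It remains to see that `T → 1` in `L¹` (`integral_abs_chainSqNorm_sub_one_le`). Multiplying a row
vector `a` by a fresh matrix with `n` columns multiplies `|a|²` by about `n`: the off-diagonal
products in the squares of the column sums are controlled by a variance bound, and the diagonal
ones, where fourth moments may be infinite, by the `L¹` law of large numbers along each row
(`integral_abs_sq_sub_le`). The relative errors compound multiplicatively over finitely many steps.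
Lévy's continuity theorem concludes. -/

open MeasureTheory ProbabilityTheory Filter Topology

/-! ### Independence of subfamilies and integration over independent blocks. -/

section Independence

variable {Ω : Type*} [MeasurableSpace Ω] {P : Measure Ω} {ι κ κ' : Type*}

/-- Two subfamilies of an independent family, indexed along maps with disjoint ranges, are
independent. -/
lemma indepFun_precomp_of_disjoint [Fintype κ] [Fintype κ'] {X : ι → Ω → ℝ}
    (hX : iIndepFun X P) (hm : ∀ i, AEMeasurable (X i) P) (f : κ → ι) (g : κ' → ι)
    (hfg : ∀ i j, f i ≠ g j) :
    IndepFun (fun ω i => X (f i) ω) (fun ω j => X (g j) ω) P := by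
  classical
  have h := hX.indepFun_finset₀ (Finset.univ.image f) (Finset.univ.image g)
    (by
      rw [Finset.disjoint_left]
      intro a ha hb
      obtain ⟨i, -, rfl⟩ := Finset.mem_image.1 ha
      obtain ⟨j, -, hj⟩ := Finset.mem_image.1 hb
      exact hfg i j hj.symm) hm
  exact h.comp
    (φ := fun x i => x ⟨f i, Finset.mem_image_of_mem f (Finset.mem_univ i)⟩)
    (ψ := fun x j => x ⟨g j, Finset.mem_image_of_mem g (Finset.mem_univ j)⟩)
    (by fun_prop) (by fun_prop)

/-- A bound on the conditional expectation given one of two independent variables yields a bound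
on the expectation. -/
lemma integral_le_of_indepFun [IsProbabilityMeasure P] {E F : Type*} [MeasurableSpace E]
    [MeasurableSpace F] {U : Ω → E} {V : Ω → F} (hUV : IndepFun U V P) (hU : AEMeasurable U P)
    (hV : AEMeasurable V P) {f : E × F → ℝ} (hf : Measurable f) (hf0 : ∀ x, 0 ≤ f x)
    {g : E → ℝ} (hg0 : ∀ u, 0 ≤ g u) (hg : Integrable (fun ω => g (U ω)) P)
    (hfg : ∀ u, Integrable (fun ω => f (u, V ω)) P ∧ ∫ ω, f (u, V ω) ∂P ≤ g u) :
    Integrable (fun ω => f (U ω, V ω)) P ∧ ∫ ω, f (U ω, V ω) ∂P ≤ ∫ ω, g (U ω) ∂P := by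
  have hfUV : AEStronglyMeasurable (fun ω => f (U ω, V ω)) P :=
    (hf.comp_aemeasurable (hU.prodMk hV)).aestronglyMeasurable
  -- Tonelli for lower integrals needs no integrability; the finiteness of the bound then supplies
  -- it.
  have key : ∫⁻ ω, ENNReal.ofReal (f (U ω, V ω)) ∂P ≤ ENNReal.ofReal (∫ ω, g (U ω) ∂P) := by
    have h1 : ∫⁻ ω, ENNReal.ofReal (f (U ω, V ω)) ∂P
        = ∫⁻ ω, ∫⁻ ω', ENNReal.ofReal (f (U ω, V ω')) ∂P ∂P := by
      have hm : Measurable (fun x : E × F => ENNReal.ofReal (f x)) := hf.ennreal_ofReal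
      rw [← lintegral_map' (f := fun x => ENNReal.ofReal (f x)) (g := fun ω => (U ω, V ω))
        hm.aemeasurable (hU.prodMk hV),
        hUV.map_prod_eq_prod_map_map hU hV,
        lintegral_prod _ hm.aemeasurable]
      have : IsProbabilityMeasure (P.map V) := Measure.isProbabilityMeasure_map hV
      rw [lintegral_map' (Measurable.lintegral_prod_right' hm).aemeasurable hU]
      refine lintegral_congr fun ω => ?_
      rw [lintegral_map' (by fun_prop) hV]
    rw [h1, ofReal_integral_eq_lintegral_ofReal hg (Eventually.of_forall fun ω => hg0 _)]
    refine lintegral_mono fun ω => ?_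
    rw [← ofReal_integral_eq_lintegral_ofReal (hfg (U ω)).1 (Eventually.of_forall fun _ => hf0 _)]
    exact ENNReal.ofReal_le_ofReal (hfg (U ω)).2
  have hint : Integrable (fun ω => f (U ω, V ω)) P := by
    refine ⟨hfUV, ?_⟩
    rw [hasFiniteIntegral_iff_ofReal (Eventually.of_forall fun ω => hf0 _)]
    exact key.trans_lt ENNReal.ofReal_lt_top
  refine ⟨hint, ?_⟩
  rw [← ofReal_integral_eq_lintegral_ofReal hint (Eventually.of_forall fun ω => hf0 _)] at key
  exact (ENNReal.ofReal_le_ofReal_iff (integral_nonneg fun ω => hg0 _)).1 key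

end Independence

/-! ### The law of large numbers for squares, in `L¹`. -/

section LawOfLargeNumbers

/-- The `L¹` distance between the empirical second moment of `n` independent samples and `1`. -/
noncomputable def meanSqError (ν : Measure ℝ) (n : ℕ) : ℝ :=
  ∫ x : Fin n → ℝ, |(n : ℝ)⁻¹ * ∑ j, x j ^ 2 - 1| ∂Measure.pi (fun _ => ν)

lemma meanSqError_nonneg (ν : Measure ℝ) (n : ℕ) : 0 ≤ meanSqError ν n :=
  integral_nonneg fun _ => abs_nonneg _

lemma integral_abs_mean_sq_sub_one {Ω : Type*} [MeasurableSpace Ω] {P : Measure Ω} {ν : Measure ℝ}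
    {n : ℕ} {X : Fin n → Ω → ℝ} (hX : iIndepFun X P) (hν : ∀ j, HasLaw (X j) ν P) :
    ∫ ω, |(n : ℝ)⁻¹ * ∑ j, X j ω ^ 2 - 1| ∂P = meanSqError ν n := by
  have h := hX.hasLaw_pi hν
  unfold meanSqError
  rw [← h.integral_comp (f := fun x : Fin n → ℝ => |(n : ℝ)⁻¹ * ∑ j, x j ^ 2 - 1|)]
  · rfl
  · exact Measurable.aestronglyMeasurable (by fun_prop)

/-- The `L¹` strong law applied to the squares, which needs only a second moment. One infinite
product space carries the samples for all `n` at once. -/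
lemma tendsto_meanSqError (ν : Measure ℝ) [IsProbabilityMeasure ν]
    (h2 : MemLp (fun x : ℝ => x) 2 ν) (hsq : ∫ x, x ^ 2 ∂ν = 1) :
    Tendsto (meanSqError ν) atTop (𝓝 0) := by
  have hind : iIndepFun (fun (i : ℕ) (ω : ℕ → ℝ) => ω i) (Measure.infinitePi fun _ => ν) :=
    iIndepFun_infinitePi (X := fun _ x => x) (fun _ => measurable_id)
  have hlaw : ∀ i : ℕ, HasLaw (fun ω : ℕ → ℝ => ω i) ν (Measure.infinitePi fun _ => ν) := fun i =>
    (measurePreserving_eval_infinitePi (fun _ : ℕ => ν) i).hasLaw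
  have hsqi : Integrable (fun x : ℝ => x ^ 2) ν := h2.integrable_sq
  have hL := strong_law_Lp (p := 1) le_rfl (by simp) (fun (i : ℕ) (ω : ℕ → ℝ) => ω i ^ 2)
    (μ := Measure.infinitePi fun _ : ℕ => ν)
    (by
      rw [memLp_one_iff_integrable]
      exact (measurePreserving_eval_infinitePi (fun _ : ℕ => ν) 0).integrable_comp_of_integrable
        hsqi)
    (fun i j hij => (hind.indepFun hij).comp (φ := fun x => x ^ 2) (ψ := fun x => x ^ 2)
      (by fun_prop) (by fun_prop))
    (fun i => ((hlaw i).identDistrib (hlaw 0)).comp (u := fun x => x ^ 2) (by fun_prop))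
  have hmean : ∫ ω : ℕ → ℝ, ω 0 ^ 2 ∂(Measure.infinitePi fun _ : ℕ => ν) = 1 := by
    rw [← hsq]
    exact (hlaw 0).integral_comp (f := fun x => x ^ 2) (by fun_prop)
  rw [hmean] at hL
  have := (ENNReal.tendsto_toReal ENNReal.zero_ne_top).comp hL
  refine this.congr fun n => ?_
  rw [← integral_abs_mean_sq_sub_one (X := fun (i : Fin n) (ω : ℕ → ℝ) => ω i)
    (hind.precomp Fin.val_injective) (fun j => hlaw j)]
  simp only [Function.comp_apply]
  rw [eLpNorm_one_eq_lintegral_enorm, ← integral_norm_eq_lintegral_enorm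
    (Measurable.aestronglyMeasurable (by fun_prop))]
  simp [Finset.sum_range]

end LawOfLargeNumbers

/-! ### Characteristic functions and a uniform central limit theorem. -/

section CharacteristicFunction

/-- Telescoping: the factors are exchanged one at a time, all others having norm at most one. -/
lemma norm_prod_sub_prod_le_sum {ι : Type*} (s : Finset ι) (f g : ι → ℂ) (hf : ∀ i, ‖f i‖ ≤ 1)
    (hg : ∀ i, ‖g i‖ ≤ 1) : ‖∏ i ∈ s, f i - ∏ i ∈ s, g i‖ ≤ ∑ i ∈ s, ‖f i - g i‖ := by
  classical
  induction s using Finset.induction_on with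
  | empty => simp
  | insert k s hk ih =>
    rw [Finset.prod_insert hk, Finset.prod_insert hk, Finset.sum_insert hk]
    have h1 : ‖∏ i ∈ s, f i‖ ≤ 1 := by
      rw [norm_prod]; exact Finset.prod_le_one (fun _ _ => norm_nonneg _) fun i _ => hf i
    calc ‖f k * ∏ i ∈ s, f i - g k * ∏ i ∈ s, g i‖
        = ‖(f k - g k) * ∏ i ∈ s, f i + g k * (∏ i ∈ s, f i - ∏ i ∈ s, g i)‖ := by ring_nf
      _ ≤ ‖f k - g k‖ * ‖∏ i ∈ s, f i‖ + ‖g k‖ * ‖∏ i ∈ s, f i - ∏ i ∈ s, g i‖ := by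
        refine (norm_add_le _ _).trans ?_
        rw [norm_mul, norm_mul]
      _ ≤ ‖f k - g k‖ * 1 + 1 * ∑ i ∈ s, ‖f i - g i‖ := by
        gcongr
        exact hg k
      _ = _ := by ring

lemma norm_exp_neg_sq_div_two_le_one (t : ℝ) : ‖Complex.exp (-(t : ℂ) ^ 2 / 2)‖ ≤ 1 := by
  rw [Complex.norm_exp, Real.exp_le_one_iff]
  have : (-(t : ℂ) ^ 2 / 2) = ((-t ^ 2 / 2 : ℝ) : ℂ) := by push_cast; ring
  rw [this, Complex.ofReal_re]
  nlinarith [sq_nonneg t]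

/-- Both functions have the second-order expansion `1 - t² / 2`, as `ν` and the standard Gaussian
share their first two moments. -/
lemma charFun_sub_exp_isLittleO (ν : Measure ℝ) [IsProbabilityMeasure ν]
    (hmean : ∫ x, x ∂ν = 0) (hsq : ∫ x, x ^ 2 ∂ν = 1) :
    (fun t : ℝ => charFun ν t - Complex.exp (-(t : ℂ) ^ 2 / 2)) =o[𝓝 0] fun t : ℝ => t ^ 2 := by
  have h1 := taylor_charFun_two (P := ν) (X := id) aemeasurable_id hmean hsq
  have h2 := taylor_charFun_two (P := gaussianReal 0 1) (X := id) aemeasurable_id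
    (by simp [integral_id_gaussianReal])
    (by
      have := variance_id_gaussianReal (μ := 0) (v := 1)
      rw [variance_eq_integral aemeasurable_id] at this
      simpa [integral_id_gaussianReal] using this)
  rw [Measure.map_id] at h1 h2
  refine (h1.sub h2).congr_left fun t => ?_
  rw [charFun_gaussianReal]
  simp [neg_div]

/-- A quantitative central limit theorem for sums of independent variables of law `ν` in which each
of the weights `b k` is used `n` times. -/
lemma exists_norm_prod_charFun_sub_exp_le (ν : Measure ℝ) [IsProbabilityMeasure ν]
    (hmean : ∫ x, x ∂ν = 0) (hsq : ∫ x, x ^ 2 ∂ν = 1) {R η : ℝ} (hR : 0 ≤ R) (hη : 0 < η) :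
    ∃ n₀ : ℕ, ∀ n ≥ n₀, ∀ (m : ℕ) (b : Fin m → ℝ), n * ∑ k, b k ^ 2 ≤ R →
      ‖∏ e : Fin m × Fin n, charFun ν (b e.1) - Complex.exp (-(n * ∑ k, b k ^ 2 : ℝ) / 2)‖ ≤ η := by
  -- `R + 1` rather than `R`, since `R = 0` is allowed (it occurs for `t = 0`).
  have hc : 0 < η / (R + 1) := by positivity
  have h := (charFun_sub_exp_isLittleO ν hmean hsq).def hc
  obtain ⟨ρ, hρ, hball⟩ := Metric.eventually_nhds_iff.1 h
  obtain ⟨n₀, hn₀⟩ := exists_nat_gt (R / ρ ^ 2)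
  refine ⟨n₀ + 1, fun n hn m b hb => ?_⟩
  have hn' : (n₀ : ℝ) + 1 ≤ n := by exact_mod_cast hn
  have hnpos : (0 : ℝ) < n := by linarith [Nat.cast_nonneg (α := ℝ) n₀]
  -- Repetition forces `b k ^ 2 ≤ R / n < ρ ^ 2`, so the Taylor estimate applies uniformly in `m`
  -- and `b`.
  have hsmall : ∀ k, dist (b k) 0 < ρ := by
    intro k
    rw [Real.dist_0_eq_abs]
    refine abs_lt_of_sq_lt_sq ?_ hρ.le
    have h1 : b k ^ 2 ≤ ∑ k, b k ^ 2 :=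
      Finset.single_le_sum (f := fun k => b k ^ 2) (fun _ _ => sq_nonneg _) (Finset.mem_univ k)
    have h2 : R < ρ ^ 2 * n := by
      rw [div_lt_iff₀ (by positivity)] at hn₀
      nlinarith [sq_nonneg ρ]
    by_contra! h3
    nlinarith
  have hexp : Complex.exp (-(n * ∑ k, b k ^ 2 : ℝ) / 2)
      = ∏ e : Fin m × Fin n, Complex.exp (-(b e.1 : ℂ) ^ 2 / 2) := by
    rw [← Complex.exp_sum, Fintype.sum_prod_type]
    congr 1
    simp only [Finset.sum_const, Finset.card_univ, Fintype.card_fin, nsmul_eq_mul]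
    push_cast
    rw [Finset.mul_sum, ← Finset.sum_neg_distrib, Finset.sum_div]
    exact Finset.sum_congr rfl fun k _ => by ring
  rw [hexp]
  refine (norm_prod_sub_prod_le_sum _ _ _ (fun _ => norm_charFun_le_one _)
    (fun _ => norm_exp_neg_sq_div_two_le_one _)).trans ?_
  calc ∑ e : Fin m × Fin n, ‖charFun ν (b e.1) - Complex.exp (-(b e.1 : ℂ) ^ 2 / 2)‖
      ≤ ∑ e : Fin m × Fin n, η / (R + 1) * b e.1 ^ 2 := by
        refine Finset.sum_le_sum fun e _ => ?_
        simpa using hball (hsmall e.1)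
    _ = η / (R + 1) * (n * ∑ k, b k ^ 2) := by
        rw [← Finset.mul_sum, Fintype.sum_prod_type]
        simp [Finset.mul_sum]
    _ ≤ η / (R + 1) * (R + 1) := by gcongr; linarith
    _ = η := by field_simp

end CharacteristicFunction

/-! ### Second moments for a single column. -/

section Columns

lemma integral_add_add {Ω : Type*} [MeasurableSpace Ω] {P : Measure Ω} {f g h : Ω → ℝ}
    (hf : Integrable f P) (hg : Integrable g P) (hh : Integrable h P) :
    ∫ ω, (f ω + g ω + h ω) ∂P = ∫ ω, f ω ∂P + ∫ ω, g ω ∂P + ∫ ω, h ω ∂P := by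
  have h1 := integral_add (hf.add hg) hh
  simp only [Pi.add_apply] at h1
  rw [h1, integral_add hf hg]

lemma memLp_two_of_hasLaw {Ω : Type*} [MeasurableSpace Ω] {P : Measure Ω} {ν : Measure ℝ} {Y : Ω → ℝ}
    (h2 : MemLp (fun x : ℝ => x) 2 ν) (hY : HasLaw Y ν P) :
    MemLp Y 2 P := by
  rw [← hY.map_eq] at h2
  exact (memLp_map_measure_iff h2.1 hY.aemeasurable).1 h2

variable {Ω : Type*} [MeasurableSpace Ω] {P : Measure Ω} [IsProbabilityMeasure P] {ν : Measure ℝ}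
  {ι : Type*} {X : ι → Ω → ℝ}

/-- The off-diagonal part of the square of a linear combination of independent standardized
variables. -/
lemma moments_sq_sub_diag (hX : iIndepFun X P) (hν : ∀ i, HasLaw (X i) ν P)
    (h2 : MemLp (fun x : ℝ => x) 2 ν) (hmean : ∫ x, x ∂ν = 0) (hsq : ∫ x, x ^ 2 ∂ν = 1)
    (a : ι → ℝ) (s : Finset ι) :
    MemLp (fun ω => ∑ i ∈ s, a i * X i ω) 2 P ∧
    ∫ ω, (∑ i ∈ s, a i * X i ω) ^ 2 ∂P = ∑ i ∈ s, a i ^ 2 ∧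
    MemLp (fun ω => (∑ i ∈ s, a i * X i ω) ^ 2 - ∑ i ∈ s, a i ^ 2 * X i ω ^ 2) 2 P ∧
    ∫ ω, ((∑ i ∈ s, a i * X i ω) ^ 2 - ∑ i ∈ s, a i ^ 2 * X i ω ^ 2) ∂P = 0 ∧
    ∫ ω, ((∑ i ∈ s, a i * X i ω) ^ 2 - ∑ i ∈ s, a i ^ 2 * X i ω ^ 2) ^ 2 ∂P
      ≤ 2 * (∑ i ∈ s, a i ^ 2) ^ 2 := by
  classical
  have hm : ∀ i, AEMeasurable (X i) P := fun i => (hν i).aemeasurable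
  -- Adding an index `k` changes the off-diagonal part by `2 * a k * S * X k`, where `X k` is
  -- centered and independent of the earlier variables. Only `X k ^ 2` ever has to be integrated.
  -- The five claims feed one another and are proved together.
  induction s using Finset.induction_on with
  | empty => simp
  | insert k s hk ih =>
    obtain ⟨hS, hS2, hZ, hZ0, hZ2⟩ := ih
    simp only [Finset.sum_insert hk]
    have hind := hX.indepFun_finset₀ s {k} (by simpa using hk) hm
    have hXk : MemLp (X k) 2 P := memLp_two_of_hasLaw h2 (hν k)
    have hXk0 : ∫ ω, X k ω ∂P = 0 := by rw [(hν k).integral_eq, hmean]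
    have hXk2 : ∫ ω, X k ω ^ 2 ∂P = 1 := by
      rw [← hsq]; exact (hν k).integral_comp (f := fun x => x ^ 2) (by fun_prop)
    set S : Ω → ℝ := fun ω => ∑ i ∈ s, a i * X i ω with hSdef
    set D : Ω → ℝ := fun ω => ∑ i ∈ s, a i ^ 2 * X i ω ^ 2 with hDdef
    have hS_eq : S = fun ω => (fun x : s → ℝ => ∑ i : s, a i * x i) (fun i : s => X i ω) := by
      funext ω
      exact (Finset.sum_coe_sort s (fun i => a i * X i ω)).symm
    have hD_eq : D = fun ω => (fun x : s → ℝ => ∑ i : s, a i ^ 2 * x i ^ 2) (fun i : s => X i ω) := by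
      funext ω
      exact (Finset.sum_coe_sort s (fun i => a i ^ 2 * X i ω ^ 2)).symm
    have hindS : IndepFun S (X k) P := by
      rw [hS_eq]
      exact hind.comp (φ := fun x : s → ℝ => ∑ i : s, a i * x i)
        (ψ := fun x : ({k} : Finset ι) → ℝ => x ⟨k, by simp⟩) (by fun_prop) (by fun_prop)
    have hindSZ : IndepFun (fun ω => S ω * (S ω ^ 2 - D ω)) (X k) P := by
      rw [hS_eq, hD_eq]
      exact hind.comp (φ := fun x : s → ℝ =>
          (∑ i : s, a i * x i) * ((∑ i : s, a i * x i) ^ 2 - ∑ i : s, a i ^ 2 * x i ^ 2))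
        (ψ := fun x : ({k} : Finset ι) → ℝ => x ⟨k, by simp⟩) (by fun_prop) (by fun_prop)
    have hindSq : IndepFun (fun ω => S ω ^ 2) (fun ω => X k ω ^ 2) P :=
      hindS.comp (φ := fun x => x ^ 2) (ψ := fun x => x ^ 2) (by fun_prop) (by fun_prop)
    have hSZ : Integrable (fun ω => S ω * (S ω ^ 2 - D ω)) P := hS.integrable_mul hZ
    have hSX : Integrable (fun ω => S ω * X k ω) P := hS.integrable_mul hXk
    have hSX0 : ∫ ω, S ω * X k ω ∂P = 0 := by
      rw [hindS.integral_fun_mul_eq_mul_integral hS.1 hXk.1, hXk0, mul_zero]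
    have hSZX : Integrable (fun ω => S ω * (S ω ^ 2 - D ω) * X k ω) P :=
      hindSZ.integrable_mul hSZ (hXk.integrable (by norm_num))
    have hSZX0 : ∫ ω, S ω * (S ω ^ 2 - D ω) * X k ω ∂P = 0 := by
      rw [hindSZ.integral_fun_mul_eq_mul_integral hSZ.1 hXk.1, hXk0, mul_zero]
    have hS2X2 : Integrable (fun ω => S ω ^ 2 * X k ω ^ 2) P :=
      hindSq.integrable_mul hS.integrable_sq hXk.integrable_sq
    have hS2X2v : ∫ ω, S ω ^ 2 * X k ω ^ 2 ∂P = ∑ i ∈ s, a i ^ 2 := by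
      rw [hindSq.integral_fun_mul_eq_mul_integral hS.integrable_sq.1 hXk.integrable_sq.1, hXk2,
        mul_one, hS2]
    have hSXm : MemLp (fun ω => S ω * X k ω) 2 P := by
      rw [memLp_two_iff_integrable_sq hSX.1]
      exact hS2X2.congr (Eventually.of_forall fun ω => by simp only; ring)
    have hZ' : ∀ ω, (a k * X k ω + S ω) ^ 2 - (a k ^ 2 * X k ω ^ 2 + D ω)
        = (S ω ^ 2 - D ω) + 2 * a k * (S ω * X k ω) := fun ω => by ring
    simp_rw [show ∀ ω, ∑ i ∈ s, a i * X i ω = S ω from fun _ => rfl,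
      show ∀ ω, ∑ i ∈ s, a i ^ 2 * X i ω ^ 2 = D ω from fun _ => rfl] at hS2 hZ hZ0 hZ2 ⊢
    refine ⟨(hXk.const_mul (a k)).add hS, ?_, ?_, ?_, ?_⟩
    · have : ∀ ω, (a k * X k ω + S ω) ^ 2
          = a k ^ 2 * X k ω ^ 2 + 2 * a k * (S ω * X k ω) + S ω ^ 2 := fun ω => by ring
      simp_rw [this]
      rw [integral_add_add (hXk.integrable_sq.const_mul _) (hSX.const_mul _) hS.integrable_sq,
        integral_const_mul,
        integral_const_mul, hXk2, hSX0, hS2]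
      ring
    · simp_rw [hZ']
      exact hZ.add (hSXm.const_mul _)
    · simp_rw [hZ']
      rw [integral_add (hZ.integrable (by norm_num)) (hSX.const_mul _), hZ0, integral_const_mul,
        hSX0]
      ring
    · simp_rw [hZ']
      have : ∀ ω, (S ω ^ 2 - D ω + 2 * a k * (S ω * X k ω)) ^ 2
          = (S ω ^ 2 - D ω) ^ 2 + 4 * a k * (S ω * (S ω ^ 2 - D ω) * X k ω)
            + 4 * a k ^ 2 * (S ω ^ 2 * X k ω ^ 2) := fun ω => by ring
      simp_rw [this]
      rw [integral_add_add hZ.integrable_sq (hSZX.const_mul _) (hS2X2.const_mul _),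
        integral_const_mul,
        integral_const_mul, hSZX0, hS2X2v]
      -- With `Q` the old sum of squares: `2 Q² + 4 (a k)² Q ≤ 2 (Q + (a k)²)²`.
      nlinarith [sq_nonneg (a k), sq_nonneg (a k ^ 2)]

end Columns

/-! ### Effect of one matrix on the squared norm of a vector. -/

section OneStep

variable {Ω : Type*} [MeasurableSpace Ω] {P : Measure Ω} [IsProbabilityMeasure P] {ν : Measure ℝ}
  {m n : ℕ} {X : Fin m × Fin n → Ω → ℝ}

/-- The columns contribute independent centered terms, so their variances add up; Cauchy–Schwarz
then bounds the `L¹` norm. -/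
lemma integral_abs_offDiag_le (hX : iIndepFun X P) (hν : ∀ e, HasLaw (X e) ν P)
    (h2 : MemLp (fun x : ℝ => x) 2 ν) (hmean : ∫ x, x ∂ν = 0) (hsq : ∫ x, x ^ 2 ∂ν = 1)
    (a : Fin m → ℝ) :
    Integrable (fun ω => ∑ j, ((∑ i, a i * X (i, j) ω) ^ 2 - ∑ i, a i ^ 2 * X (i, j) ω ^ 2)) P ∧
    ∫ ω, |∑ j, ((∑ i, a i * X (i, j) ω) ^ 2 - ∑ i, a i ^ 2 * X (i, j) ω ^ 2)| ∂P
      ≤ √(2 * n) * ∑ i, a i ^ 2 := by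
  have hm : ∀ i, AEMeasurable (X i) P := fun i => (hν i).aemeasurable
  set Z : Fin n → Ω → ℝ := fun j ω =>
    (∑ i, a i * X (i, j) ω) ^ 2 - ∑ i, a i ^ 2 * X (i, j) ω ^ 2 with hZdef
  have hcol : ∀ j, MemLp (Z j) 2 P ∧ ∫ ω, Z j ω ∂P = 0 ∧
      ∫ ω, Z j ω ^ 2 ∂P ≤ 2 * (∑ i, a i ^ 2) ^ 2 := fun j =>
    (moments_sq_sub_diag (X := fun i => X (i, j)) (hX.precomp (Prod.mk_left_injective j))
      (fun i => hν _) h2 hmean hsq a Finset.univ).2.2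
  have hpair : Set.Pairwise (↑(Finset.univ : Finset (Fin n))) fun j j' => IndepFun (Z j) (Z j') P := by
    intro j _ j' _ hjj'
    have h := indepFun_precomp_of_disjoint hX hm (fun i : Fin m => (i, j)) (fun i : Fin m => (i, j'))
      (by rintro i i' h; exact hjj' (Prod.ext_iff.1 h).2)
    exact h.comp (φ := fun x : Fin m → ℝ => (∑ i, a i * x i) ^ 2 - ∑ i, a i ^ 2 * x i ^ 2)
      (ψ := fun x : Fin m → ℝ => (∑ i, a i * x i) ^ 2 - ∑ i, a i ^ 2 * x i ^ 2)
      (by fun_prop) (by fun_prop)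
  have hsum : MemLp (∑ j, Z j) 2 P := memLp_finsetSum' _ fun j _ => (hcol j).1
  have hmean0 : ∫ ω, (∑ j, Z j) ω ∂P = 0 := by
    simp only [Finset.sum_apply]
    rw [integral_finsetSum _ fun j _ => (hcol j).1.integrable (by norm_num)]
    exact Finset.sum_eq_zero fun j _ => (hcol j).2.1
  have hvar : ∫ ω, (∑ j, Z j) ω ^ 2 ∂P ≤ n * (2 * (∑ i, a i ^ 2) ^ 2) := by
    have h := IndepFun.variance_sum (fun j _ => (hcol j).1) hpair
    rw [variance_of_integral_eq_zero hsum.aemeasurable hmean0] at h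
    rw [h]
    refine (Finset.sum_le_sum fun j _ => ?_).trans_eq
      (by simp : ∑ _j : Fin n, 2 * (∑ i, a i ^ 2) ^ 2 = _)
    rw [variance_of_integral_eq_zero (hcol j).1.aemeasurable (hcol j).2.1]
    exact (hcol j).2.2
  have hint : Integrable (∑ j, Z j) P := hsum.integrable (by norm_num)
  have heq : (∑ j, Z j) = fun ω => ∑ j, Z j ω := by funext ω; simp
  rw [heq] at hsum hvar hint
  refine ⟨hint, ?_⟩
  have hQ : 0 ≤ ∑ i, a i ^ 2 := Finset.sum_nonneg fun _ _ => sq_nonneg _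
  refine abs_le_of_sq_le_sq' ?_ (by positivity) |>.2
  -- Nonnegativity of this variance is the Cauchy–Schwarz inequality `(E|Y|)² ≤ E Y²`.
  have hv := variance_nonneg (fun ω => |∑ j, Z j ω|) P
  rw [variance_eq_sub (show MemLp (fun ω => |∑ j, Z j ω|) 2 P from hsum.abs)] at hv
  simp only [Pi.pow_apply, sq_abs] at hv
  rw [mul_pow, Real.sq_sqrt (by positivity)]
  linarith

/-- Summing over `j` first turns the error into a combination, with weights `n * a i ^ 2`, of row
errors that all have the same `L¹` norm. -/
lemma integral_abs_diag_le (hX : iIndepFun X P) (hν : ∀ e, HasLaw (X e) ν P)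
    (h2 : MemLp (fun x : ℝ => x) 2 ν) (hn : 0 < n) (a : Fin m → ℝ) :
    Integrable (fun ω => ∑ j, ∑ i, a i ^ 2 * X (i, j) ω ^ 2 - n * ∑ i, a i ^ 2) P ∧
    ∫ ω, |∑ j, ∑ i, a i ^ 2 * X (i, j) ω ^ 2 - n * ∑ i, a i ^ 2| ∂P
      ≤ n * meanSqError ν n * ∑ i, a i ^ 2 := by
  have hn' : (n : ℝ) ≠ 0 := by positivity
  have hsqi : ∀ e, Integrable (fun ω => X e ω ^ 2) P := fun e =>
    (memLp_two_of_hasLaw h2 (hν e)).integrable_sq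
  have hW : ∀ i, Integrable (fun ω => (n : ℝ)⁻¹ * ∑ j, X (i, j) ω ^ 2 - 1) P := fun i =>
    ((integrable_finsetSum _ fun j _ => hsqi (i, j)).const_mul _).sub (integrable_const _)
  have hrow : ∀ i, ∫ ω, |(n : ℝ)⁻¹ * ∑ j, X (i, j) ω ^ 2 - 1| ∂P = meanSqError ν n := fun i =>
    integral_abs_mean_sq_sub_one (X := fun j => X (i, j))
      (hX.precomp (Prod.mk_right_injective i)) fun j => hν _
  have heq : ∀ ω, ∑ j, ∑ i, a i ^ 2 * X (i, j) ω ^ 2 - n * ∑ i, a i ^ 2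
      = ∑ i, n * a i ^ 2 * ((n : ℝ)⁻¹ * ∑ j, X (i, j) ω ^ 2 - 1) := by
    intro ω
    rw [Finset.sum_comm, Finset.mul_sum, ← Finset.sum_sub_distrib]
    refine Finset.sum_congr rfl fun i _ => ?_
    rw [← Finset.mul_sum]
    field_simp
  simp_rw [heq]
  refine ⟨integrable_finsetSum _ fun i _ => (hW i).const_mul _, ?_⟩
  calc ∫ ω, |∑ i, n * a i ^ 2 * ((n : ℝ)⁻¹ * ∑ j, X (i, j) ω ^ 2 - 1)| ∂P
      ≤ ∫ ω, ∑ i, n * a i ^ 2 * |(n : ℝ)⁻¹ * ∑ j, X (i, j) ω ^ 2 - 1| ∂P := by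
        refine integral_mono (integrable_finsetSum _ fun i _ => (hW i).const_mul _).abs
          (integrable_finsetSum _ fun i _ => (hW i).abs.const_mul _) fun ω => ?_
        refine (Finset.abs_sum_le_sum_abs _ _).trans_eq (Finset.sum_congr rfl fun i _ => ?_)
        rw [abs_mul, abs_of_nonneg (by positivity : 0 ≤ n * a i ^ 2)]
    _ = ∑ i, n * a i ^ 2 * meanSqError ν n := by
        rw [integral_finsetSum _ fun i _ => (hW i).abs.const_mul _]
        simp_rw [integral_const_mul, hrow]
    _ = _ := by
        rw [Finset.mul_sum]
        exact Finset.sum_congr rfl fun i _ => by ring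

/-- The relative error made when the squared norm of `a * X` is replaced by `n` times the squared
norm of `a`, for a matrix `X` with `n` columns and independent standardized entries. -/
noncomputable def stepError (ν : Measure ℝ) (n : ℕ) : ℝ := √(2 / n) + meanSqError ν n

lemma stepError_nonneg (ν : Measure ℝ) (n : ℕ) : 0 ≤ stepError ν n :=
  add_nonneg (Real.sqrt_nonneg _) (meanSqError_nonneg ν n)

lemma tendsto_stepError (ν : Measure ℝ) [IsProbabilityMeasure ν]
    (h2 : MemLp (fun x : ℝ => x) 2 ν) (hsq : ∫ x, x ^ 2 ∂ν = 1) :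
    Tendsto (stepError ν) atTop (𝓝 0) := by
  have h : Tendsto (fun n : ℕ => √(2 / n)) atTop (𝓝 0) := by
    rw [← Real.sqrt_zero]
    exact (Real.continuous_sqrt.tendsto 0).comp (tendsto_const_div_atTop_nhds_zero_nat 2)
  rw [← add_zero (0 : ℝ)]
  exact h.add (tendsto_meanSqError ν h2 hsq)

lemma integral_abs_sq_sub_le (hX : iIndepFun X P) (hν : ∀ e, HasLaw (X e) ν P)
    (h2 : MemLp (fun x : ℝ => x) 2 ν) (hmean : ∫ x, x ∂ν = 0) (hsq : ∫ x, x ^ 2 ∂ν = 1)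
    (hn : 0 < n) (a : Fin m → ℝ) :
    Integrable (fun ω => ∑ j, (∑ i, a i * X (i, j) ω) ^ 2 - n * ∑ i, a i ^ 2) P ∧
    ∫ ω, |∑ j, (∑ i, a i * X (i, j) ω) ^ 2 - n * ∑ i, a i ^ 2| ∂P
      ≤ n * stepError ν n * ∑ i, a i ^ 2 := by
  obtain ⟨ho, ho'⟩ := integral_abs_offDiag_le hX hν h2 hmean hsq a
  obtain ⟨hd, hd'⟩ := integral_abs_diag_le hX hν h2 hn a
  have heq : ∀ ω, ∑ j, (∑ i, a i * X (i, j) ω) ^ 2 - n * ∑ i, a i ^ 2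
      = ∑ j, ((∑ i, a i * X (i, j) ω) ^ 2 - ∑ i, a i ^ 2 * X (i, j) ω ^ 2)
        + (∑ j, ∑ i, a i ^ 2 * X (i, j) ω ^ 2 - n * ∑ i, a i ^ 2) := by
    intro ω
    rw [Finset.sum_sub_distrib]
    ring
  simp_rw [heq]
  refine ⟨ho.add hd, ?_⟩
  have hsqrt : √(2 * n) = n * √(2 / n) := by
    have hn' : (0 : ℝ) < n := by positivity
    rw [← Real.sqrt_sq hn'.le, ← Real.sqrt_mul (by positivity)]
    congr 1
    rw [Real.sqrt_sq hn'.le]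
    field_simp
  calc _ ≤ ∫ ω, (|∑ j, ((∑ i, a i * X (i, j) ω) ^ 2 - ∑ i, a i ^ 2 * X (i, j) ω ^ 2)|
        + |∑ j, ∑ i, a i ^ 2 * X (i, j) ω ^ 2 - n * ∑ i, a i ^ 2|) ∂P :=
        integral_mono (ho.add hd).abs (ho.abs.add hd.abs) fun ω => abs_add_le _ _
    _ ≤ √(2 * n) * ∑ i, a i ^ 2 + n * meanSqError ν n * ∑ i, a i ^ 2 := by
        rw [integral_add ho.abs hd.abs]
        exact add_le_add ho' hd'
    _ = _ := by rw [hsqrt, stepError]; ring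

end OneStep

/-! ### Concentration of the squared norm along the chain. -/

section Chain

/-- The positions of the entries of a chain of `p` matrices. -/
abbrev ChainIndex (p : ℕ) (n : Fin (p + 1) → ℕ) : Type :=
  (q : Fin p) × (Fin (n q.castSucc) × Fin (n q.succ))

/-- The positions of the entries of all matrices of the chain but the last. -/
def ChainIndex.init {p : ℕ} {n : Fin (p + 2) → ℕ} (e : ChainIndex p fun k => n k.castSucc) :
    ChainIndex (p + 1) n :=
  ⟨e.1.castSucc, e.2⟩

/-- The positions of the entries of the last matrix of the chain. -/
def ChainIndex.last {p : ℕ} {n : Fin (p + 2) → ℕ}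
    (e : Fin (n (Fin.last p).castSucc) × Fin (n (Fin.last p).succ)) : ChainIndex (p + 1) n :=
  ⟨Fin.last p, e⟩

lemma ChainIndex.init_ne_last {p : ℕ} {n : Fin (p + 2) → ℕ}
    (e : ChainIndex p fun k => n k.castSucc)
    (e' : Fin (n (Fin.last p).castSucc) × Fin (n (Fin.last p).succ)) :
    (ChainIndex.init e : ChainIndex (p + 1) n) ≠ ChainIndex.last e' :=
  fun h => (Fin.castSucc_lt_last e.1).ne (congrArg Sigma.fst h)

lemma ChainIndex.init_injective {p : ℕ} {n : Fin (p + 2) → ℕ} :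
    Function.Injective (ChainIndex.init (n := n)) := by
  rintro ⟨q, e⟩ ⟨q', e'⟩ h
  have h1 : q = q' := Fin.castSucc_injective _ (congrArg Sigma.fst h)
  subst h1
  exact congrArg (Sigma.mk q) (eq_of_heq (Sigma.mk.inj_iff.1 h).2)

lemma ChainIndex.last_injective {p : ℕ} {n : Fin (p + 2) → ℕ} :
    Function.Injective (ChainIndex.last (n := n)) :=
  fun _ _ h => eq_of_heq (Sigma.mk.inj_iff.1 h).2

/-- The sums of the columns of the product of a chain of matrices. -/
noncomputable def chainColSum (p : ℕ) (n : Fin (p + 1) → ℕ) (x : ChainIndex p n → ℝ)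
    (j : Fin (n (Fin.last p))) : ℝ :=
  ∑ i, chainProd p n (fun q => Matrix.of fun i j => x ⟨q, (i, j)⟩) i j

lemma chainColSum_zero (n : Fin 1 → ℕ) (x : ChainIndex 0 n → ℝ) (j : Fin (n 0)) :
    chainColSum 0 n x j = 1 := by
  unfold chainColSum chainProd
  exact (Finset.sum_congr rfl fun i _ => Matrix.one_apply).trans (by simp)

/-- Column sums form the all-ones row vector times the product, so a further matrix acts on them
from the right. -/
lemma chainColSum_succ (p : ℕ) (n : Fin (p + 2) → ℕ) (x : ChainIndex (p + 1) n → ℝ)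
    (j : Fin (n (Fin.last (p + 1)))) :
    chainColSum (p + 1) n x j =
      ∑ k, chainColSum p (fun k => n k.castSucc) (fun e => x (ChainIndex.init e)) k
        * x (ChainIndex.last (k, j)) := by
  refine (Finset.sum_congr rfl fun i _ => Matrix.mul_apply).trans ?_
  refine Finset.sum_comm.trans (Finset.sum_congr rfl fun k _ => ?_)
  exact (Finset.sum_mul _ _ _).symm

lemma normalizedSum_eq (p : ℕ) (n : Fin (p + 1) → ℕ) (x : ChainIndex p n → ℝ) :
    normalizedSum p n (fun q => Matrix.of fun i j => x ⟨q, (i, j)⟩) =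
      (∏ k, (n k : ℝ)) ^ (-(1 / 2) : ℝ) * ∑ j, chainColSum p n x j :=
  congrArg (_ * ·) Finset.sum_comm

lemma measurable_chainColSum (p : ℕ) (n : Fin (p + 1) → ℕ) (j : Fin (n (Fin.last p))) :
    Measurable fun x : ChainIndex p n → ℝ => chainColSum p n x j := by
  induction p with
  | zero =>
    have : (fun x : ChainIndex 0 n → ℝ => chainColSum 0 n x j) = fun _ => 1 :=
      funext fun x => chainColSum_zero n x j
    rw [this]
    exact measurable_const
  | succ p ih =>
    simp only [chainColSum_succ]
    refine Finset.measurable_fun_sum _ fun k _ => Measurable.mul ?_ (measurable_pi_apply _)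
    have hinit : Measurable fun (x : ChainIndex (p + 1) n → ℝ)
        (e : ChainIndex p fun k => n k.castSucc) => x (ChainIndex.init e) :=
      measurable_pi_lambda _ fun e => measurable_pi_apply (ChainIndex.init e)
    exact (ih (fun k => n k.castSucc) k).comp hinit

/-- The normalized squared norm of the vector of column sums. -/
noncomputable def chainSqNorm (p : ℕ) (n : Fin (p + 1) → ℕ) (x : ChainIndex p n → ℝ) : ℝ :=
  (∏ k, (n k : ℝ))⁻¹ * ∑ j, chainColSum p n x j ^ 2

lemma chainSqNorm_nonneg (p : ℕ) (n : Fin (p + 1) → ℕ) (x : ChainIndex p n → ℝ) :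
    0 ≤ chainSqNorm p n x :=
  mul_nonneg (inv_nonneg.2 (Finset.prod_nonneg fun _ _ => Nat.cast_nonneg _))
    (Finset.sum_nonneg fun _ _ => sq_nonneg _)

lemma measurable_chainSqNorm (p : ℕ) (n : Fin (p + 1) → ℕ) : Measurable (chainSqNorm p n) :=
  (Finset.measurable_fun_sum _ fun j _ => (measurable_chainColSum p n j).pow_const 2).const_mul _

/-- The squared norm of the column sums concentrates around `1`. -/
lemma integral_abs_chainSqNorm_sub_one_le (p : ℕ) (n : Fin (p + 1) → ℕ) (hn : ∀ k, 0 < n k)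
    (μ : Fin p → Measure ℝ)
    (h2 : ∀ q, MemLp (fun x : ℝ => x) 2 (μ q)) (hmean : ∀ q, ∫ x, x ∂(μ q) = 0)
    (hsq : ∀ q, ∫ x, x ^ 2 ∂(μ q) = 1) {Ω : Type*} [MeasurableSpace Ω] {P : Measure Ω}
    [IsProbabilityMeasure P] {X : ChainIndex p n → Ω → ℝ} (hX : iIndepFun X P)
    (hlaw : ∀ e, HasLaw (X e) (μ e.1) P) :
    Integrable (fun ω => chainSqNorm p n (fun e => X e ω)) P ∧
    1 + ∫ ω, |chainSqNorm p n (fun e => X e ω) - 1| ∂P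
      ≤ ∏ q, (1 + stepError (μ q) (n q.succ)) := by
  -- Adding `1` to the error makes the recursion multiplicative: if `T'` is the next value after
  -- `T`, then `E|T' - T| ≤ ε E T ≤ ε (1 + E|T - 1|)`.
  induction p with
  | zero =>
    have h0 : ∀ x, chainSqNorm 0 n x = 1 := by
      intro x
      have : (n 0 : ℝ) ≠ 0 := by exact_mod_cast (hn 0).ne'
      have h1 : ∑ j, chainColSum 0 n x j ^ 2 = (n 0 : ℝ) :=
        (Finset.sum_congr rfl fun j _ => by rw [chainColSum_zero]).trans
          (by simp)
      rw [chainSqNorm, h1]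
      simp [this]
    simp [h0]
  | succ p ih =>
    set l : ℕ := n (Fin.last p).succ with hl
    have hm : ∀ e, AEMeasurable (X e) P := fun e => (hlaw e).aemeasurable
    set n' : Fin (p + 1) → ℕ := fun k => n k.castSucc with hn'
    obtain ⟨hTi, hT⟩ := ih n' (fun k => hn _) (fun q => μ q.castSucc) (fun q => h2 _)
      (fun q => hmean _) (fun q => hsq _) (X := fun e => X (ChainIndex.init e))
      (hX.precomp ChainIndex.init_injective) (fun e => hlaw _)
    set U : Ω → ChainIndex p n' → ℝ := fun ω e => X (ChainIndex.init e) ω with hU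
    set V : Ω → Fin (n (Fin.last p).castSucc) × Fin l → ℝ :=
      fun ω e => X (ChainIndex.last e) ω with hV
    have hUV : IndepFun U V P := indepFun_precomp_of_disjoint hX hm _ _ ChainIndex.init_ne_last
    have hUm : AEMeasurable U P := aemeasurable_pi_lambda _ fun e => hm _
    have hVm : AEMeasurable V P := aemeasurable_pi_lambda _ fun e => hm _
    have hlpos : 0 < l := hn _
    have hlpos' : (0 : ℝ) < l := by exact_mod_cast hlpos
    set N : ℝ := ∏ k, (n' k : ℝ) with hN
    have hNpos : 0 < N := Finset.prod_pos fun k _ => by exact_mod_cast hn _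
    have hNl : ∏ k, (n k : ℝ) = N * l := Fin.prod_univ_castSucc _
    set c : (ChainIndex p n' → ℝ) → Fin (n' (Fin.last p)) → ℝ := chainColSum p n' with hc
    -- The increment `|T' - T|` as a function of the earlier matrices and the last one; freezing the
    -- former reduces it to the one-step estimate.
    set f : (ChainIndex p n' → ℝ) × (Fin (n (Fin.last p).castSucc) × Fin l → ℝ) → ℝ :=
      fun z => |(N * l)⁻¹ * (∑ j, (∑ k, c z.1 k * z.2 (k, j)) ^ 2 - l * ∑ k, c z.1 k ^ 2)| with hf
    have hfm : Measurable f := by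
      have hcm : ∀ k, Measurable fun z : (ChainIndex p n' → ℝ) ×
          (Fin (n (Fin.last p).castSucc) × Fin l → ℝ) => c z.1 k := fun k =>
        (measurable_chainColSum p n' k).comp measurable_fst
      have hzm : ∀ e, Measurable fun z : (ChainIndex p n' → ℝ) ×
          (Fin (n (Fin.last p).castSucc) × Fin l → ℝ) => z.2 e := fun e =>
        (measurable_pi_apply e).comp measurable_snd
      refine Measurable.abs (Measurable.const_mul (Measurable.sub ?_ (Measurable.const_mul ?_ _)) _)
      · exact Finset.measurable_fun_sum _ fun j _ =>
          (Finset.measurable_fun_sum _ fun k _ => (hcm k).mul (hzm (k, j))).pow_const 2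
      · exact Finset.measurable_fun_sum _ fun k _ => (hcm k).pow_const 2
    have hstep : ∀ u, Integrable (fun ω => f (u, V ω)) P ∧
        ∫ ω, f (u, V ω) ∂P ≤ stepError (μ (Fin.last p)) l * chainSqNorm p n' u := by
      intro u
      obtain ⟨hi, hb⟩ := integral_abs_sq_sub_le (X := fun e => X (ChainIndex.last e))
        (hX.precomp ChainIndex.last_injective) (fun e => hlaw _) (h2 (Fin.last p))
        (hmean (Fin.last p)) (hsq (Fin.last p)) hlpos (c u)
      refine ⟨(hi.const_mul _).abs, ?_⟩
      simp only [hf, abs_mul, integral_const_mul]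
      rw [abs_of_pos (by positivity)]
      refine (mul_le_mul_of_nonneg_left hb (by positivity)).trans_eq ?_
      rw [chainSqNorm, ← hN, ← hc]
      field_simp
      rfl
    obtain ⟨hfi, hfb⟩ := integral_le_of_indepFun hUV hUm hVm hfm (fun _ => abs_nonneg _)
      (fun u => mul_nonneg (stepError_nonneg _ _) (chainSqNorm_nonneg p n' u))
      (hTi.const_mul _) hstep
    rw [integral_const_mul] at hfb
    have hdiff : ∀ ω, f (U ω, V ω)
        = |chainSqNorm (p + 1) n (fun e => X e ω) - chainSqNorm p n' (U ω)| := by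
      intro ω
      have : chainSqNorm (p + 1) n (fun e => X e ω)
          = (N * l)⁻¹ * ∑ j, (∑ k, c (U ω) k * V ω (k, j)) ^ 2 := by
        rw [chainSqNorm, hNl]
        simp only [chainColSum_succ]
        rfl
      rw [this, chainSqNorm, ← hN, ← hc]
      simp only [hf]
      congr 1
      field_simp
    simp_rw [hdiff] at hfi hfb
    have hm1 : AEStronglyMeasurable (fun ω => chainSqNorm (p + 1) n (fun e => X e ω)) P :=
      ((measurable_chainSqNorm _ n).comp_aemeasurable
        (aemeasurable_pi_lambda _ fun e => hm e)).aestronglyMeasurable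
    have hdi : Integrable (fun ω => chainSqNorm (p + 1) n (fun e => X e ω)
        - chainSqNorm p n' (U ω)) P :=
      (integrable_norm_iff (hm1.sub hTi.1)).1 hfi
    have hSi : Integrable (fun ω => chainSqNorm (p + 1) n (fun e => X e ω)) P :=
      (hdi.add hTi).congr (Eventually.of_forall fun ω => sub_add_cancel _ _)
    refine ⟨hSi, ?_⟩
    have hTi1 : Integrable (fun ω => chainSqNorm p n' (U ω) - 1) P := hTi.sub (integrable_const _)
    have hSi1 : Integrable (fun ω => chainSqNorm (p + 1) n (fun e => X e ω) - 1) P :=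
      hSi.sub (integrable_const _)
    have htri : ∫ ω, |chainSqNorm (p + 1) n (fun e => X e ω) - 1| ∂P
        ≤ stepError (μ (Fin.last p)) l * ∫ ω, chainSqNorm p n' (U ω) ∂P
          + ∫ ω, |chainSqNorm p n' (U ω) - 1| ∂P := by
      refine le_trans ?_ (add_le_add_left hfb _)
      rw [← integral_add hfi hTi1.abs]
      exact integral_mono hSi1.abs (hfi.add hTi1.abs) fun ω => abs_sub_le _ _ _
    have hTle : ∫ ω, chainSqNorm p n' (U ω) ∂P ≤ 1 + ∫ ω, |chainSqNorm p n' (U ω) - 1| ∂P := by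
      have h1 : (1 : ℝ) = ∫ _ω, (1 : ℝ) ∂P := by simp
      nth_rw 1 [h1]
      rw [← integral_add (integrable_const _) hTi1.abs]
      exact integral_mono hTi ((integrable_const _).add hTi1.abs) fun ω => by
        have := le_abs_self (chainSqNorm p n' (U ω) - 1)
        simp only
        linarith
    rw [Fin.prod_univ_castSucc]
    have hs := stepError_nonneg (μ (Fin.last p)) l
    calc 1 + ∫ ω, |chainSqNorm (p + 1) n (fun e => X e ω) - 1| ∂P
        ≤ (1 + ∫ ω, |chainSqNorm p n' (U ω) - 1| ∂P) * (1 + stepError (μ (Fin.last p)) l) := by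
          nlinarith [mul_le_mul_of_nonneg_left hTle hs]
      _ ≤ _ := mul_le_mul_of_nonneg_right hT (by linarith)

end Chain

/-! ### Conditioning on all matrices but the last. -/

section Limit

lemma abs_exp_neg_sub_exp_neg_le {x y : ℝ} (hx : 0 ≤ x) (hy : 0 ≤ y) :
    |Real.exp (-x) - Real.exp (-y)| ≤ |x - y| := by
  wlog h : x ≤ y generalizing x y
  · rw [abs_sub_comm, abs_sub_comm x y]
    exact this hy hx (not_le.1 h).le
  rw [abs_of_nonneg (sub_nonneg.2 (Real.exp_le_exp.2 (neg_le_neg h))), abs_of_nonpos (by linarith)]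
  have h1 : Real.exp (-y) = Real.exp (-x) * Real.exp (x - y) := by
    rw [← Real.exp_add]; ring_nf
  have h2 := Real.add_one_le_exp (x - y)
  have h3 : Real.exp (-x) ≤ 1 := Real.exp_le_one_iff.2 (by linarith)
  rw [h1]
  nlinarith [Real.exp_pos (-x)]

lemma integral_exp_sum_mul_I {Ω : Type*} [MeasurableSpace Ω] {P : Measure Ω} {ν : Measure ℝ} {κ : Type*}
    [Fintype κ] {X : κ → Ω → ℝ}
    (hX : iIndepFun X P) (hν : ∀ e, HasLaw (X e) ν P) (b : κ → ℝ) :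
    ∫ ω, Complex.exp ((∑ e, b e * X e ω : ℝ) * Complex.I) ∂P = ∏ e, charFun ν (b e) := by
  have h := hX.integral_fun_prod_comp (fun e => (hν e).aemeasurable)
    (f := fun e (x : ℝ) => Complex.exp ((b e : ℂ) * x * Complex.I))
    (fun e => Measurable.aestronglyMeasurable (by fun_prop))
  have h1 : ∀ e, ∫ ω, Complex.exp ((b e : ℂ) * (X e ω : ℂ) * Complex.I) ∂P = charFun ν (b e) := by
    intro e
    rw [charFun_apply_real]
    exact (hν e).integral_comp (f := fun x : ℝ => Complex.exp ((b e : ℂ) * x * Complex.I))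
      (Measurable.aestronglyMeasurable (by fun_prop))
  simp_rw [h1] at h
  rw [← h]
  refine integral_congr_ae (Eventually.of_forall fun ω => ?_)
  simp only
  rw [← Complex.exp_sum]
  push_cast
  rw [Finset.sum_mul]

variable {Ω : Type*} [MeasurableSpace Ω] {P : Measure Ω} [IsProbabilityMeasure P]

/-- Fubini for the product law of `(U, V)`; it plays the role of conditioning on `U`. -/
lemma integral_eq_integral_integral_of_indepFun {E F : Type*} [MeasurableSpace E]
    [MeasurableSpace F] {U : Ω → E} {V : Ω → F} (hUV : IndepFun U V P) (hU : AEMeasurable U P)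
    (hV : AEMeasurable V P) {f : E × F → ℂ} (hf : Measurable f) (hf1 : ∀ x, ‖f x‖ ≤ 1) :
    Integrable (fun ω => ∫ ω', f (U ω, V ω') ∂P) P ∧
    ∫ ω, f (U ω, V ω) ∂P = ∫ ω, ∫ ω', f (U ω, V ω') ∂P ∂P := by
  have hPU : IsProbabilityMeasure (P.map U) := Measure.isProbabilityMeasure_map hU
  have hPV : IsProbabilityMeasure (P.map V) := Measure.isProbabilityMeasure_map hV
  have hint : Integrable f ((P.map U).prod (P.map V)) :=
    Integrable.of_bound hf.aestronglyMeasurable 1 (Eventually.of_forall hf1)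
  have hin : ∀ u, ∫ v, f (u, v) ∂(P.map V) = ∫ ω', f (u, V ω') ∂P := fun u =>
    integral_map hV (hf.comp measurable_prodMk_left).aestronglyMeasurable
  have hleft := hint.integral_prod_left
  have h1 : ∫ ω, f (U ω, V ω) ∂P = ∫ z, f z ∂((P.map U).prod (P.map V)) := by
    rw [← hUV.map_prod_eq_prod_map_map hU hV,
      integral_map (hU.prodMk hV) hf.aestronglyMeasurable]
  rw [h1, integral_prod _ hint]
  simp_rw [hin] at hleft ⊢
  exact ⟨hleft.comp_aemeasurable hU, integral_map hU hleft.1⟩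

/-- The characteristic function of the normalized sum is close to that of the standard Gaussian
law as soon as the last size is large and the squared norm of the column sums of the product of
the other matrices is close to `1`. -/
lemma norm_integral_exp_normalizedSum_sub_le {p : ℕ} {n : Fin (p + 2) → ℕ} (hn : ∀ k, 0 < n k)
    {ν : Measure ℝ} [IsProbabilityMeasure ν] {X : ChainIndex (p + 1) n → Ω → ℝ} (hX : iIndepFun X P)
    (hm : ∀ e, AEMeasurable (X e) P) (hlast : ∀ e, HasLaw (X (ChainIndex.last e)) ν P)
    (hT : Integrable (fun ω => chainSqNorm p (fun k => n k.castSucc)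
      fun e => X (ChainIndex.init e) ω) P)
    {t η : ℝ} (hη : 0 ≤ η)
    (hclt : ∀ (m : ℕ) (b : Fin m → ℝ), (n (Fin.last (p + 1)) : ℝ) * ∑ k, b k ^ 2 ≤ 2 * t ^ 2 →
      ‖∏ e : Fin m × Fin (n (Fin.last (p + 1))), charFun ν (b e.1)
        - Complex.exp (-((n (Fin.last (p + 1)) : ℝ) * ∑ k, b k ^ 2 : ℝ) / 2)‖ ≤ η) :
    ‖∫ ω, Complex.exp (t * (normalizedSum (p + 1) n
        (fun q => Matrix.of fun i j => X ⟨q, (i, j)⟩ ω) : ℝ) * Complex.I) ∂P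
      - Complex.exp (-(t : ℂ) ^ 2 / 2)‖
      ≤ η + (2 + t ^ 2 / 2) * ∫ ω, |chainSqNorm p (fun k => n k.castSucc)
        (fun e => X (ChainIndex.init e) ω) - 1| ∂P := by
  set l : ℕ := n (Fin.last (p + 1)) with hl
  have hlpos' : (0 : ℝ) < l := by exact_mod_cast hn _
  set n' : Fin (p + 1) → ℕ := fun k => n k.castSucc with hn'
  set U : Ω → ChainIndex p n' → ℝ := fun ω e => X (ChainIndex.init e) ω with hU
  set V : Ω → Fin (n' (Fin.last p)) × Fin l → ℝ :=
    fun ω e => X (ChainIndex.last e) ω with hV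
  have hUV : IndepFun U V P := indepFun_precomp_of_disjoint hX hm _ _ ChainIndex.init_ne_last
  have hUm : AEMeasurable U P := aemeasurable_pi_lambda _ fun e => hm _
  have hVm : AEMeasurable V P := aemeasurable_pi_lambda _ fun e => hm _
  set N : ℝ := ∏ k, (n' k : ℝ) with hN
  have hNpos : 0 < N := Finset.prod_pos fun k _ => by exact_mod_cast hn _
  have hNl : ∏ k, (n k : ℝ) = N * l := Fin.prod_univ_castSucc _
  set r : ℝ := (N * l) ^ (-(1 / 2) : ℝ) with hr
  have hr2 : r ^ 2 = (N * l)⁻¹ := by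
    rw [hr, ← Real.rpow_natCast, ← Real.rpow_mul (by positivity), ← Real.rpow_neg_one]
    norm_num
  -- The weights absorb both `t` and the normalization, so that `l * ∑ b²` is exactly `t² T`.
  set b : (ChainIndex p n' → ℝ) → Fin (n' (Fin.last p)) → ℝ :=
    fun u k => t * r * chainColSum p n' u k with hb
  have hbsq : ∀ u, (l : ℝ) * ∑ k, b u k ^ 2 = t ^ 2 * chainSqNorm p n' u := by
    intro u
    simp only [hb, mul_pow, hr2]
    rw [← Finset.mul_sum, chainSqNorm, ← hN]
    field_simp
  set f : (ChainIndex p n' → ℝ) × (Fin (n' (Fin.last p)) × Fin l → ℝ) → ℂ :=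
    fun z => Complex.exp ((∑ e, b z.1 e.1 * z.2 e : ℝ) * Complex.I) with hf
  have hfm : Measurable f := by
    have hcm : ∀ k, Measurable fun z : (ChainIndex p n' → ℝ) ×
        (Fin (n' (Fin.last p)) × Fin l → ℝ) => b z.1 k := fun k =>
      ((measurable_chainColSum p n' k).const_mul _).comp measurable_fst
    have hzm : ∀ e, Measurable fun z : (ChainIndex p n' → ℝ) ×
        (Fin (n' (Fin.last p)) × Fin l → ℝ) => z.2 e := fun e =>
      (measurable_pi_apply e).comp measurable_snd
    exact ((Complex.measurable_ofReal.comp (Finset.measurable_fun_sum _ fun e _ =>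
      (hcm e.1).mul (hzm e))).mul_const _).cexp
  obtain ⟨hGi, hG⟩ := integral_eq_integral_integral_of_indepFun hUV hUm hVm hfm
    (fun z => (Complex.norm_exp_ofReal_mul_I _).le)
  have hinner : ∀ u, ∫ ω, f (u, V ω) ∂P
      = ∏ e : Fin (n' (Fin.last p)) × Fin l, charFun ν (b u e.1) := fun u =>
    integral_exp_sum_mul_I (X := fun e => X (ChainIndex.last e))
      (hX.precomp ChainIndex.last_injective) hlast (fun e => b u e.1)
  have hS : ∀ ω, Complex.exp (t * (normalizedSum (p + 1) n
      (fun q => Matrix.of fun i j => X ⟨q, (i, j)⟩ ω) : ℝ) * Complex.I) = f (U ω, V ω) := by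
    intro ω
    have h1 : t * normalizedSum (p + 1) n (fun q => Matrix.of fun i j => X ⟨q, (i, j)⟩ ω)
        = ∑ e, b (U ω) e.1 * V ω e := by
      have h2 : normalizedSum (p + 1) n (fun q => Matrix.of fun i j => X ⟨q, (i, j)⟩ ω)
          = r * ∑ j, chainColSum (p + 1) n (fun e => X e ω) j := by
        rw [hr, ← hNl]
        exact normalizedSum_eq (p + 1) n fun e => X e ω
      rw [h2, Fintype.sum_prod_type, Finset.sum_comm, ← mul_assoc, Finset.mul_sum]
      refine Finset.sum_congr rfl fun j _ => ?_
      rw [chainColSum_succ, Finset.mul_sum]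
      refine Finset.sum_congr rfl fun k _ => ?_
      rw [← mul_assoc]
    change _ = Complex.exp ((∑ e, b (U ω) e.1 * V ω e : ℝ) * Complex.I)
    rw [← h1]
    push_cast
    rfl
  simp_rw [hS]
  simp_rw [hinner] at hG hGi
  rw [hG]
  have hsub : ∫ ω, ∏ e : Fin (n' (Fin.last p)) × Fin l, charFun ν (b (U ω) e.1) ∂P
      - Complex.exp (-(t : ℂ) ^ 2 / 2)
      = ∫ ω, (∏ e : Fin (n' (Fin.last p)) × Fin l, charFun ν (b (U ω) e.1)
        - Complex.exp (-(t : ℂ) ^ 2 / 2)) ∂P := by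
    rw [integral_sub hGi (integrable_const _)]
    simp
  have hTi : Integrable (fun ω => |chainSqNorm p n' (U ω) - 1|) P :=
    (hT.sub (integrable_const _)).abs
  have hrhs : ∫ ω, (η + (2 + t ^ 2 / 2) * |chainSqNorm p n' (U ω) - 1|) ∂P
      = η + (2 + t ^ 2 / 2) * ∫ ω, |chainSqNorm p n' (U ω) - 1| ∂P := by
    rw [integral_add (integrable_const _) (hTi.const_mul _), integral_const_mul]
    simp
  rw [hsub, ← hrhs]
  refine norm_integral_le_of_norm_le ((integrable_const _).add (hTi.const_mul _))
    (Eventually.of_forall fun ω => ?_)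
  set T := chainSqNorm p n' (U ω) with hTdef
  have hT0 : 0 ≤ T := chainSqNorm_nonneg _ _ _
  have ht2 := sq_nonneg t
  -- For `T ≤ 2` the central limit estimate applies with budget `2 * t ^ 2`. For `T > 2` the trivial
  -- bound `2` on the difference is at most `2 * |T - 1|`.
  rcases le_or_gt T 2 with h | h
  · have h1 := hclt _ (b (U ω)) (by rw [hbsq]; nlinarith)
    rw [hbsq] at h1
    have h2 : ‖Complex.exp (-(t ^ 2 * T : ℝ) / 2) - Complex.exp (-(t : ℂ) ^ 2 / 2)‖
        ≤ t ^ 2 / 2 * |T - 1| := by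
      have h3 := abs_exp_neg_sub_exp_neg_le (x := t ^ 2 * T / 2) (y := t ^ 2 / 2) (by positivity)
        (by positivity)
      have h4 : t ^ 2 * T / 2 - t ^ 2 / 2 = t ^ 2 / 2 * (T - 1) := by ring
      rw [h4, abs_mul, abs_of_nonneg (by positivity : 0 ≤ t ^ 2 / 2)] at h3
      refine le_trans (le_of_eq ?_) h3
      rw [← Real.norm_eq_abs, ← Complex.norm_real]
      push_cast
      congr 3 <;> ring
    calc _ ≤ η + t ^ 2 / 2 * |T - 1| := (norm_sub_le_norm_sub_add_norm_sub _ _ _).trans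
          (add_le_add h1 h2)
      _ ≤ _ := by nlinarith [abs_nonneg (T - 1)]
  · have h1 : ‖∏ e : Fin (n' (Fin.last p)) × Fin l, charFun ν (b (U ω) e.1)‖ ≤ 1 := by
      rw [norm_prod]
      exact Finset.prod_le_one (fun _ _ => norm_nonneg _) fun e _ => norm_charFun_le_one _
    have h2 := norm_exp_neg_sq_div_two_le_one t
    have h3 := le_abs_self (T - 1)
    refine (norm_sub_le _ _).trans ?_
    nlinarith [abs_nonneg (T - 1)]

end Limit

/-! ### The main theorem. -/

open MeasureTheory ProbabilityTheory Filter in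
/-- For every size vector `n = (n 0, …, n p)` the matrices live on a probability space `Ω n` of
their own; only the laws `μ q` of the entries are kept fixed. The filter `atTop` on size vectors
means that all of `n 0, …, n p` tend to infinity. -/
theorem theorem1p5 (α : ℝ) (hα : 1 < α) (p : ℕ) (hp : 1 ≤ p)
    (μ : Fin p → Measure ℝ) [∀ q, IsProbabilityMeasure (μ q)]
    (hmoment : ∀ q, MemLp (fun x : ℝ => x) (ENNReal.ofReal (2 * α)) (μ q))
    (hmean : ∀ q, ∫ x, x ∂(μ q) = 0)
    (hvar : ∀ q, Var[fun x : ℝ => x; μ q] = 1)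
    {Ω : (Fin (p + 1) → ℕ) → Type*} [∀ n, MeasurableSpace (Ω n)]
    (P : ∀ n, Measure (Ω n)) [∀ n, IsProbabilityMeasure (P n)]
    (A : ∀ (n : Fin (p + 1) → ℕ) (q : Fin p),
      Fin (n q.castSucc) → Fin (n q.succ) → Ω n → ℝ)
    (hlaw : ∀ n q i j, HasLaw (A n q i j) (μ q) (P n))
    (hindep : ∀ n, iIndepFun
      (fun (e : (q : Fin p) × (Fin (n q.castSucc) × Fin (n q.succ))) =>
        A n e.1 e.2.1 e.2.2) (P n)) :
    TendstoInDistribution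
      (fun n ω => normalizedSum p n (fun q => Matrix.of fun i j => A n q i j ω))
      atTop (fun x : ℝ => x) P (gaussianReal 0 1) := by
  have h2 : ∀ q, MemLp (fun x : ℝ => x) 2 (μ q) := fun q =>
    (hmoment q).mono_exponent (by
      rw [← ENNReal.ofReal_ofNat]
      exact ENNReal.ofReal_le_ofReal (by linarith))
  have hsq : ∀ q, ∫ x, x ^ 2 ∂(μ q) = 1 := fun q => by
    rw [← hvar q, variance_of_integral_eq_zero (h2 q).aemeasurable (hmean q)]
  -- Isolates the last matrix; from here on `p` counts the others.
  obtain ⟨p, rfl⟩ : ∃ p', p = p' + 1 := ⟨p - 1, by omega⟩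
  let X : ∀ n, ChainIndex (p + 1) n → Ω n → ℝ := fun n e => A n e.1 e.2.1 e.2.2
  have hlawX : ∀ n e, HasLaw (X n e) (μ e.1) (P n) := fun n e => hlaw n _ _ _
  have hm : ∀ n e, AEMeasurable (X n e) (P n) := fun n e => (hlawX n e).aemeasurable
  have hSm : ∀ n, AEMeasurable (fun ω => normalizedSum (p + 1) n
      (fun q => Matrix.of fun i j => A n q i j ω)) (P n) := by
    intro n
    have h1 : (fun ω => normalizedSum (p + 1) n (fun q => Matrix.of fun i j => A n q i j ω))
        = fun ω => (∏ k, (n k : ℝ)) ^ (-(1 / 2) : ℝ)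
          * ∑ j, chainColSum (p + 1) n (fun e => X n e ω) j := by
      funext ω
      exact normalizedSum_eq (p + 1) n fun e => X n e ω
    rw [h1]
    exact ((Finset.measurable_fun_sum _ fun j _ =>
      measurable_chainColSum (p + 1) n j).comp_aemeasurable
        (aemeasurable_pi_lambda _ fun e => hm n e)).const_mul _
  have hsize : ∀ k, Tendsto (fun n : Fin (p + 2) → ℕ => n k) atTop atTop := fun k =>
    tendsto_atTop.2 fun c => (eventually_ge_atTop fun _ => c).mono fun n h => h k
  have hchar : ∀ t : ℝ, Tendsto (fun n => charFun ((P n).map fun ω => normalizedSum (p + 1) n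
      (fun q => Matrix.of fun i j => A n q i j ω)) t) atTop
      (𝓝 (charFun ((gaussianReal 0 1).map fun x : ℝ => x) t)) := by
    intro t
    have hlim : charFun ((gaussianReal 0 1).map fun x : ℝ => x) t
        = Complex.exp (-(t : ℂ) ^ 2 / 2) := by
      rw [Measure.map_id', charFun_gaussianReal]
      simp [neg_div]
    rw [hlim, Metric.tendsto_nhds]
    intro ε hε
    obtain ⟨n₀, hn₀⟩ := exists_norm_prod_charFun_sub_exp_le (μ (Fin.last p)) (hmean _) (hsq _)
      (R := 2 * t ^ 2) (η := ε / 2) (by positivity) (by positivity)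
    -- A fixed finite number of factors, each tending to `1`, whatever the relative growth of the
    -- sizes.
    have hprod : Tendsto (fun n : Fin (p + 2) → ℕ => (2 + t ^ 2 / 2) *
        (∏ q : Fin p, (1 + stepError (μ q.castSucc) (n q.succ.castSucc)) - 1)) atTop (𝓝 0) := by
      have h1 : Tendsto (fun n : Fin (p + 2) → ℕ =>
          ∏ q : Fin p, (1 + stepError (μ q.castSucc) (n q.succ.castSucc))) atTop
          (𝓝 (∏ _q : Fin p, (1 + 0))) :=
        tendsto_finsetProd _ fun q _ => tendsto_const_nhds.add
          ((tendsto_stepError _ (h2 _) (hsq _)).comp (hsize _))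
      simpa using (h1.sub_const 1).const_mul (2 + t ^ 2 / 2)
    have hpos : ∀ᶠ n : Fin (p + 2) → ℕ in atTop, ∀ k, 0 < n k :=
      (eventually_ge_atTop fun _ => 1).mono fun n h k => h k
    filter_upwards [hpos, (hsize (Fin.last (p + 1))).eventually_ge_atTop n₀,
      hprod.eventually_lt_const (half_pos hε)] with n hn hnl hnp
    obtain ⟨hTi, hT⟩ := integral_abs_chainSqNorm_sub_one_le p (fun k => n k.castSucc)
      (fun k => hn _) (fun q => μ q.castSucc) (fun q => h2 _) (fun q => hmean _) (fun q => hsq _)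
      (X := fun e => X n (ChainIndex.init e)) ((hindep n).precomp ChainIndex.init_injective)
      (fun e => hlawX n _)
    have hmain := norm_integral_exp_normalizedSum_sub_le hn (hindep n) (hm n)
      (fun e => hlawX n (ChainIndex.last e)) hTi (t := t) (half_pos hε).le (hn₀ _ hnl)
    rw [dist_eq_norm, charFun_apply_real,
      integral_map (hSm n) (Measurable.aestronglyMeasurable (by fun_prop))]
    refine hmain.trans_lt ?_
    have h3 : (2 + t ^ 2 / 2) * ∫ ω, |chainSqNorm p (fun k => n k.castSucc)
        (fun e => X n (ChainIndex.init e) ω) - 1| ∂(P n) ≤ (2 + t ^ 2 / 2) *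
        (∏ q : Fin p, (1 + stepError (μ q.castSucc) (n q.succ.castSucc)) - 1) :=
      mul_le_mul_of_nonneg_left (by linarith) (by positivity)
    linarith
  refine ⟨hSm, aemeasurable_id', ?_⟩
  -- The filter on size vectors is countably generated, so the continuity theorem may be applied
  -- along sequences.
  refine tendsto_of_seq_tendsto fun u hu => ?_
  exact ProbabilityMeasure.tendsto_of_tendsto_charFun fun t => (hchar t).comp hu
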